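/- A continuum is a nonempty compact connected metrizable space; a subcontinuum is a subset that is a continuum. A continuum is hereditarily unicoherent if for every subcontinuum $K$ and all subcontinua $A,B$ with $A\cup B=K$, the set $A\cap B$ is a continuum. A tree is a continuum that is a union of finitely many arcs and in which any two distinct points are the endpoints of exactly one arc. A continuum is tree-like if it is homeomorphic to the inverse limit of a sequence of trees with continuous (single-valued) bonding maps. A Cantor set is a closed, perfect, nowhere dense subset $C$ of $[0,1]$; a point $x\in C$ is an endpoint of $C$ if $(a,x)\subseteq[0,1]\setminus C$ for some $a<x$ or $(x,a)\subseteq[0,1]\setminus C$ for some $a>x$. Let $\{C_r : r\in\mathbb{Q}\cap[0,1]\}$ be a collection of Cantor sets contained in $(0,1]$ such that, whenever $r>s$, $C_r\subsetneq C_s$ and no point of $C_r$ is an endpoint of $C_s$. Let $f:[0,1]\to[0,1]$ be a continuous function such that $f(t)=0$ for all $t\in\{0\}\cup C_0$, $f(t)<\min C_0$ for all $t\in[0,1]$, and $f(t)<t$ for all $t\in(0,1]$. Define the set-valued function $F$ on $[0,1]$ by $$F(t)=\begin{cases}\{f(t)\} & \text{if } t\notin C_0,\\ [0,\sup\{r :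 t\in C_r\}] & \text{if } t\in C_0,\end{cases}$$ and let $$X=\varprojlim\{[0,1],F\}=\{(x_0,x_1,x_2,\dots)\in[0,1]^{\mathbb{N}} : x_{i-1}\in F(x_i)\text{ for all } i\ge 1\},$$ a subspace of the product space $[0,1]^{\mathbb{N}}$. **Proposition.** $X$ is a tree-like continuum, and $X$ is hereditarily unicoherent. -/

import Mathlib

open Set Topology unitInterval

namespace TreeLikeLimit

/-! ### Continua, unicoherence, trees -/

/-- A continuum: a nonempty, compact, connected, metrizable space. -/
def IsContinuum (X : Type*) [TopologicalSpace X] : Prop :=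
  CompactSpace X ∧ ConnectedSpace X ∧ TopologicalSpace.MetrizableSpace X

/-- A subset that is itself a continuum, for subsets of a metrizable space
(`IsConnected` includes nonemptiness). -/
def IsSubcontinuum {X : Type*} [TopologicalSpace X] (K : Set X) : Prop :=
  IsCompact K ∧ IsConnected K

/-- A subcontinuum `K` is unicoherent: whenever it is the union of two subcontinua, these meet in
a continuum. -/
def IsUnicoherent {X : Type*} [TopologicalSpace X] (K : Set X) : Prop :=
  IsSubcontinuum K ∧
    ∀ A B : Set X, IsSubcontinuum A → IsSubcontinuum B → A ∪ B = K → IsSubcontinuum (A ∩ B)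

/-- A continuum all of whose subcontinua are unicoherent. -/
def IsHereditarilyUnicoherent (X : Type*) [TopologicalSpace X] : Prop :=
  IsContinuum X ∧ ∀ K : Set X, IsSubcontinuum K → IsUnicoherent K

/-- `A` is an arc (a homeomorphic copy of `[0,1]`) with endpoints `x` and `y`. -/
def IsArcBetween {X : Type*} [TopologicalSpace X] (A : Set X) (x y : X) : Prop :=
  ∃ γ : I → X, IsEmbedding γ ∧ γ 0 = x ∧ γ 1 = y ∧ range γ = A

/-- `A` is an arc. -/
def IsArc {X : Type*} [TopologicalSpace X] (A : Set X) : Prop :=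
  ∃ x y : X, IsArcBetween A x y

/-- A tree: a continuum that is the union of finitely many arcs and in which any two distinct
points are the endpoints of exactly one arc. -/
def IsTopTree (T : Type*) [TopologicalSpace T] : Prop :=
  IsContinuum T ∧
    (∃ 𝒜 : Set (Set T), 𝒜.Finite ∧ (∀ A ∈ 𝒜, IsArc A) ∧ ⋃₀ 𝒜 = univ) ∧
    ∀ x y : T, x ≠ y → ∃! A : Set T, IsArcBetween A x y

/-! ### Inverse limits -/

/-- The inverse limit of a sequence of spaces with set-valued bonding functions
`f i : X (i + 1) → 2 ^ X i`, as a subset of the product. -/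
def invLim {X : ℕ → Type*} (f : ∀ i, X (i + 1) → Set (X i)) : Set (∀ i, X i) :=
  {x | ∀ i, x i ∈ f i (x (i + 1))}

/-- A continuum homeomorphic to the inverse limit of a sequence of trees with continuous
(single-valued) bonding maps. -/
def IsTreeLike (X : Type*) [TopologicalSpace X] : Prop :=
  IsContinuum X ∧
    ∃ (T : ℕ → Type) (_ : ∀ i, TopologicalSpace (T i)) (g : ∀ i, T (i + 1) → T i),
      (∀ i, IsTopTree (T i)) ∧ (∀ i, Continuous (g i)) ∧
        Nonempty (X ≃ₜ invLim (X := T) (fun i t => {g i t}))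

/-! ### Cantor sets in `[0,1]` -/

/-- A closed, perfect, nowhere dense subset of `[0,1]` (`Perfect` includes closedness). -/
def IsCantorSet (C : Set I) : Prop :=
  Perfect C ∧ IsNowhereDense C

/-- `x` is a left or a right endpoint of `C`. -/
def IsEndpointOf (C : Set I) (x : I) : Prop :=
  x ∈ C ∧ ((∃ a < x, Ioo a x ⊆ Cᶜ) ∨ (∃ a > x, Ioo x a ⊆ Cᶜ))

/-- A family of Cantor sets in `(0,1]`, indexed by the rationals of `[0,1]`, such that for `s < r`
the set `C r` is a proper subset of `C s` and contains no endpoint of `C s`. -/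
def IsNestedCantorFamily (C : Icc (0 : ℚ) 1 → Set I) : Prop :=
  (∀ r, IsCantorSet (C r) ∧ C r ⊆ Ioc 0 1) ∧
    ∀ r s, s < r → C r ⊂ C s ∧ ∀ x ∈ C r, ¬ IsEndpointOf (C s) x

/-- The conditions on the single-valued map `f : [0,1] → [0,1]`. -/
def IsBaseMap (C : Icc (0 : ℚ) 1 → Set I) (f : I → I) : Prop :=
  Continuous f ∧ (∀ t ∈ {0} ∪ C 0, f t = 0) ∧ (∀ t, ∀ c ∈ C 0, f t < c) ∧ ∀ t ∈ Ioc 0 1, f t < t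

open scoped Classical in
/-- The set-valued function `F`: `F t = {f t}` for `t ∉ C 0`, and `F t = [0, sup {r : t ∈ C r}]`
for `t ∈ C 0`. -/
noncomputable def bondF (C : Icc (0 : ℚ) 1 → Set I) (f : I → I) (t : I) : Set I :=
  if t ∈ C 0 then
    {y | (y : ℝ) ≤ sSup ((fun r : Icc (0 : ℚ) 1 => ((r : ℚ) : ℝ)) '' {r | t ∈ C r})}
  else {f t}

/-- The inverse limit `X` of `[0,1]` with the single bonding function `F`. -/
noncomputable def limX (C : Icc (0 : ℚ) 1 → Set I) (f : I → I) : Set (ℕ → I) :=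
  invLim (X := fun _ => I) (fun _ => bondF C f)

end TreeLikeLimit

namespace TreeLikeLimit

/-! ### Arcs -/

section Arcs

variable {Z W : Type*} [TopologicalSpace Z] [TopologicalSpace W]

/-! Values of `f` lie below `C 0`, so once a coordinate of a point of `X` is in `C 0`, all later
ones are. A coordinate `x i` with `x (i + 1) ∉ C 0` equals `f (x (i + 1))` and carries no
information. Replacing each such coordinate by `0` (`straighten`) is continuous, because `f`
vanishes on `C 0`, and injective, because `f t < t` leaves only the zero sequence without a
coordinate in `C 0`. The new sequences satisfy `z i ≤ h (z (i + 1))`, where `h` is `hairHeight`,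
upper semicontinuous and zero off `C 0`: an arc with a hair of length `h t` at each `t ∈ C 0`, hairs
on the hairs, and so on.

Monotone maps `p k`, finer and finer, with `p k '' C 0` finite (`exists_collapsing_sequence`) turn
the first `k + 1` coordinates of this picture into an arc with finitely many smaller trees attached
(`isArcTree_truncatedLimit`). Points of `C 0` identified by `p k` carry nested trees, and
semicontinuity provides a largest one.

The resulting maps from `X` to trees are coherent and separate points, so `X` is the inverse limit
of their images (`exists_homeomorph_invLim_range`). Two subcontinua have connected images, which
meet in a connected set inside a tree; compactness carries this back to the intersection of the
subcontinua (`isPreconnected_inter_of_images`). -/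

theorem IsArcBetween.left_mem {A : Set Z} {x y : Z} (h : IsArcBetween A x y) : x ∈ A := by
  obtain ⟨γ, -, rfl, -, rfl⟩ := h
  exact mem_range_self _

theorem IsArcBetween.right_mem {A : Set Z} {x y : Z} (h : IsArcBetween A x y) : y ∈ A := by
  obtain ⟨γ, -, -, rfl, rfl⟩ := h
  exact mem_range_self _

theorem IsArcBetween.isPreconnected {A : Set Z} {x y : Z} (h : IsArcBetween A x y) :
    IsPreconnected A := by
  obtain ⟨γ, hγ, -, -, rfl⟩ := h
  exact isPreconnected_range hγ.continuous

theorem IsArcBetween.symm {A : Set Z} {x y : Z} (h : IsArcBetween A x y) :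
    IsArcBetween A y x := by
  obtain ⟨γ, hγ, h0, h1, hr⟩ := h
  refine ⟨γ ∘ unitInterval.symmHomeomorph, hγ.comp unitInterval.symmHomeomorph.isEmbedding,
    by simp [h1], by simp [h0], ?_⟩
  rw [unitInterval.symmHomeomorph.surjective.range_comp, hr]

/-- Two arcs that meet only in a common endpoint form an arc. -/
theorem IsArcBetween.trans [T2Space Z] {A B : Set Z} {x v y : Z} (hA : IsArcBetween A x v)
    (hB : IsArcBetween B v y) (hAB : A ∩ B ⊆ {v}) : IsArcBetween (A ∪ B) x y := by
  obtain ⟨γ, hγ, h0, h1, rfl⟩ := hA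
  obtain ⟨δ, hδ, k0, k1, rfl⟩ := hB
  let p : Path x v := ⟨⟨γ, hγ.continuous⟩, h0, h1⟩
  let q : Path v y := ⟨⟨δ, hδ.continuous⟩, k0, k1⟩
  have hp : ∀ t, p t = γ t := fun _ => rfl
  have hq : ∀ t, q t = δ t := fun _ => rfl
  -- A coincidence between the two halves can only be `v = δ 0`, which puts the second parameter at
  -- `1 / 2`.
  have key : ∀ a b : I, (a : ℝ) ≤ 1 / 2 → ¬ (b : ℝ) ≤ 1 / 2 → p.trans q a ≠ p.trans q b := by
    intro a b ha hb hab
    rw [Path.trans_apply, Path.trans_apply, dif_pos ha, dif_neg hb, hp, hq] at hab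
    have hv := hAB ⟨mem_range_self _, ⟨_, hab.symm⟩⟩
    rw [hab, mem_singleton_iff, ← k0] at hv
    have := congrArg Subtype.val (hδ.injective hv)
    simp only [Icc.coe_zero] at this
    apply hb
    linarith
  have hinj : Function.Injective (p.trans q) := by
    intro a b hab
    by_cases ha : (a : ℝ) ≤ 1 / 2 <;> by_cases hb : (b : ℝ) ≤ 1 / 2
    · rw [Path.trans_apply, Path.trans_apply, dif_pos ha, dif_pos hb, hp, hp] at hab
      have := congrArg Subtype.val (hγ.injective hab)
      simp only at this
      exact Subtype.ext (by linarith)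
    · exact (key a b ha hb hab).elim
    · exact (key b a hb ha hab.symm).elim
    · rw [Path.trans_apply, Path.trans_apply, dif_neg ha, dif_neg hb, hq, hq] at hab
      have := congrArg Subtype.val (hδ.injective hab)
      simp only at this
      exact Subtype.ext (by linarith)
  exact ⟨p.trans q, ((p.trans q).continuous.isClosedEmbedding hinj).isEmbedding,
    (p.trans q).source, (p.trans q).target, Path.trans_range p q⟩

theorem IsArcBetween.image {A S : Set Z} {x y : Z} (h : IsArcBetween A x y) {φ : Z → W}
    {ψ : W → Z} (hφ : Continuous φ) (hψ : Continuous ψ) (hAS : A ⊆ S)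
    (hinv : ∀ z ∈ S, ψ (φ z) = z) : IsArcBetween (φ '' A) (φ x) (φ y) := by
  obtain ⟨γ, hγ, rfl, rfl, rfl⟩ := h
  refine ⟨φ ∘ γ, ?_, rfl, rfl, range_comp φ γ⟩
  refine IsEmbedding.of_comp (hφ.comp hγ.continuous) hψ ?_
  have : ψ ∘ φ ∘ γ = γ := funext fun t => hinv _ (hAS (mem_range_self t))
  rwa [this]

/-- An arc contained in another arc with the same endpoints is equal to it. -/
theorem IsArcBetween.eq_of_subset [T2Space Z] {A B : Set Z} {x y : Z} (hA : IsArcBetween A x y)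
    (hB : IsArcBetween B x y) (h : A ⊆ B) : A = B := by
  obtain ⟨δ, hδ, k0, k1, rfl⟩ := hB
  have hpre : IsPreconnected (δ ⁻¹' A) :=
    (hδ.isInducing.isPreconnected_image).1 (by
      rw [image_preimage_eq_of_subset h]; exact hA.isPreconnected)
  have h0 : (0 : I) ∈ δ ⁻¹' A := by rw [mem_preimage, k0]; exact hA.left_mem
  have h1 : (1 : I) ∈ δ ⁻¹' A := by rw [mem_preimage, k1]; exact hA.right_mem
  refine h.antisymm ?_
  rintro _ ⟨t, rfl⟩
  exact hpre.Icc_subset h0 h1 ⟨nonneg', le_one'⟩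

end Arcs

/-! ### Sets in which arcs are the irreducible connected sets -/

/-- A nonempty compact set that is a finite union of arcs and points, in which any two points are
joined by an arc that lies in every connected subset containing both. -/
structure IsArcTree {Z : Type*} [TopologicalSpace Z] (S : Set Z) : Prop where
  compact : IsCompact S
  nonempty : S.Nonempty
  arcs : ∀ x ∈ S, ∀ y ∈ S, x ≠ y → ∃ A ⊆ S, IsArcBetween A x y ∧
    ∀ K ⊆ S, IsPreconnected K → x ∈ K → y ∈ K → A ⊆ K
  finite : ∃ 𝒜 : Set (Set Z), 𝒜.Finite ∧ (∀ A ∈ 𝒜, IsArc A ∨ ∃ x, A = {x}) ∧ ⋃₀ 𝒜 = S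

section ArcTree

variable {Z W : Type*} [TopologicalSpace Z] [TopologicalSpace W]

/-- The minimal arc between two common points lies in both sets. -/
theorem IsArcTree.isPreconnected_inter {S K L : Set Z} (hS : IsArcTree S) (hKS : K ⊆ S)
    (hLS : L ⊆ S) (hK : IsPreconnected K) (hL : IsPreconnected L) : IsPreconnected (K ∩ L) := by
  refine isPreconnected_of_forall_pair fun x hx y hy => ?_
  by_cases hxy : x = y
  · exact ⟨{x}, by simpa using hx, rfl, hxy.symm, isPreconnected_singleton⟩
  · obtain ⟨A, -, hA, hmin⟩ := hS.arcs x (hKS hx.1) y (hKS hy.1) hxy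
    exact ⟨A, subset_inter (hmin K hKS hK hx.1 hy.1) (hmin L hLS hL hx.2 hy.2), hA.left_mem,
      hA.right_mem, hA.isPreconnected⟩

theorem IsArcTree.isPreconnected {S : Set Z} (hS : IsArcTree S) : IsPreconnected S := by
  refine isPreconnected_of_forall_pair fun x hx y hy => ?_
  by_cases hxy : x = y
  · exact ⟨{x}, by simpa using hx, rfl, hxy.symm, isPreconnected_singleton⟩
  · obtain ⟨A, hAS, hA, -⟩ := hS.arcs x hx y hy hxy
    exact ⟨A, hAS, hA.left_mem, hA.right_mem, hA.isPreconnected⟩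

theorem IsArcTree.image {S : Set Z} (hS : IsArcTree S) {φ : Z → W} {ψ : W → Z}
    (hφ : Continuous φ) (hψ : Continuous ψ) (hinv : ∀ z ∈ S, ψ (φ z) = z) :
    IsArcTree (φ '' S) where
  compact := hS.compact.image hφ
  nonempty := hS.nonempty.image φ
  arcs := by
    rintro _ ⟨x, hx, rfl⟩ _ ⟨y, hy, rfl⟩ hxy
    obtain ⟨A, hAS, hA, hmin⟩ := hS.arcs x hx y hy fun h => hxy (congrArg φ h)
    refine ⟨φ '' A, image_mono hAS, hA.image hφ hψ hAS hinv, fun K hKS hK hxK hyK => ?_⟩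
    have hsub : ψ '' K ⊆ S := by
      rintro _ ⟨k, hk, rfl⟩
      obtain ⟨z, hz, rfl⟩ := hKS hk
      rwa [hinv z hz]
    have := hmin (ψ '' K) hsub (hK.image ψ hψ.continuousOn) ⟨_, hxK, hinv x hx⟩
      ⟨_, hyK, hinv y hy⟩
    rintro _ ⟨a, ha, rfl⟩
    obtain ⟨k, hk, hka⟩ := this ha
    obtain ⟨z, hz, rfl⟩ := hKS hk
    rw [hinv z hz] at hka
    rwa [← hka]
  finite := by
    obtain ⟨𝒜, hfin, hA, hU⟩ := hS.finite
    refine ⟨(fun A => φ '' A) '' 𝒜, hfin.image _, ?_, by rw [← hU, image_sUnion]⟩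
    rintro _ ⟨A, hA', rfl⟩
    rcases hA A hA' with ⟨x, y, h⟩ | ⟨x, rfl⟩
    · exact .inl ⟨_, _, h.image hφ hψ ((subset_sUnion_of_mem hA').trans hU.le) hinv⟩
    · exact .inr ⟨φ x, image_singleton⟩

theorem isArcBetween_Icc {a b : ℝ} (h : a < b) : IsArcBetween (Icc a b) a b := by
  refine ⟨Subtype.val ∘ (iccHomeoI a b h).symm, IsEmbedding.subtypeVal.comp
    (iccHomeoI a b h).symm.isEmbedding, by simp, by simp, ?_⟩
  rw [(iccHomeoI a b h).symm.surjective.range_comp, Subtype.range_coe]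

theorem isArcTree_Icc {a b : ℝ} (h : a ≤ b) : IsArcTree (Icc a b) where
  compact := isCompact_Icc
  nonempty := nonempty_Icc.2 h
  arcs := by
    intro x hx y hy hxy
    rcases hxy.lt_or_gt with hlt | hlt
    · exact ⟨Icc x y, Icc_subset_Icc hx.1 hy.2, isArcBetween_Icc hlt,
        fun K _ hK hxK hyK => hK.Icc_subset hxK hyK⟩
    · exact ⟨Icc y x, Icc_subset_Icc hy.1 hx.2, (isArcBetween_Icc hlt).symm,
        fun K _ hK hxK hyK => hK.Icc_subset hyK hxK⟩
  finite := by
    rcases h.eq_or_lt with rfl | hlt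
    · exact ⟨{{a}}, finite_singleton _, by simp, by simp⟩
    · exact ⟨{Icc a b}, finite_singleton _,
        by rintro _ rfl; exact .inl ⟨a, b, isArcBetween_Icc hlt⟩, by simp⟩

/-- A connected set in a wedge of two closed sets traces a connected set on each of them. -/
theorem isPreconnected_inter_of_wedge {S T K : Set Z} {v : Z} (hS : IsClosed S) (hT : IsClosed T)
    (hST : S ∩ T = {v}) (hK : IsPreconnected K) (hKST : K ⊆ S ∪ T) :
    IsPreconnected (K ∩ S) := by
  have hvS : v ∈ S := (hST.ge rfl).1
  have hvT : v ∈ T := (hST.ge rfl).2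
  by_cases hv : v ∈ K
  · rw [isPreconnected_closed_iff] at hK ⊢
    rintro U V hU hV hcov ⟨a, ⟨haK, haS⟩, haU⟩ ⟨b, ⟨hbK, hbS⟩, hbV⟩
    wlog hvU : v ∈ U generalizing U V a b
    · have hvV : v ∈ V := (hcov ⟨hv, hvS⟩).resolve_left hvU
      obtain ⟨z, hz, h1, h2⟩ :=
        this V U hV hU (by rwa [union_comm]) b hbV hbK hbS a haU haK haS hvV
      exact ⟨z, hz, h2, h1⟩
    -- With `v ∈ U`, all of `T` can be added to the `U` side: a point that `T` shares with `V ∩ S`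
    -- is `v` itself, which lies in `U`.
    obtain ⟨z, hzK, hz1, hz2⟩ := hK ((U ∩ S) ∪ T) (V ∩ S) ((hU.inter hS).union hT) (hV.inter hS)
      (by
        intro z hz
        rcases hKST hz with h | h
        · rcases hcov ⟨hz, h⟩ with h' | h'
          · exact .inl (.inl ⟨h', h⟩)
          · exact .inr ⟨h', h⟩
        · exact .inl (.inr h))
      ⟨a, haK, .inl ⟨haU, haS⟩⟩ ⟨b, hbK, hbV, hbS⟩
    rcases hz1 with h | h
    · exact ⟨z, ⟨hzK, hz2.2⟩, h.1, hz2.1⟩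
    · obtain rfl : z = v := hST.le ⟨hz2.2, h⟩
      exact ⟨z, ⟨hzK, hvS⟩, hvU, hz2.1⟩
  · rcases (K ∩ S).eq_empty_or_nonempty with h | h
    · rw [h]; exact isPreconnected_empty
    · have : K ⊆ S := by
        by_contra hne
        obtain ⟨z, hzK, hzS⟩ := not_subset.1 hne
        obtain ⟨w, hwK, hw⟩ := isPreconnected_closed_iff.1 hK S T hS hT hKST h
          ⟨z, hzK, (hKST hzK).resolve_left hzS⟩
        rw [hST] at hw
        exact hv (hw ▸ hwK)
      rwa [inter_eq_left.2 this]

theorem mem_of_isPreconnected_of_wedge {S T K : Set Z} {v : Z} (hS : IsClosed S) (hT : IsClosed T)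
    (hST : S ∩ T = {v}) (hK : IsPreconnected K) (hKST : K ⊆ S ∪ T) (h1 : (K ∩ S).Nonempty)
    (h2 : (K ∩ T).Nonempty) : v ∈ K := by
  obtain ⟨w, hwK, hw⟩ := isPreconnected_closed_iff.1 hK S T hS hT hKST h1 h2
  rw [hST] at hw
  exact hw ▸ hwK

/-- Traces of a connected set on `S` and `T` are connected, so minimality is inherited from each
side; a connected set reaching both sides passes through `v`, where the two minimal arcs are joined.
-/
theorem IsArcTree.exists_arc_union [T2Space Z] {S T : Set Z} {v : Z} (hS : IsArcTree S)
    (hT : IsArcTree T) (hST : S ∩ T = {v}) {x y : Z} (hx : x ∈ S) (hy : y ∈ S ∪ T)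
    (hxy : x ≠ y) : ∃ A ⊆ S ∪ T, IsArcBetween A x y ∧
    ∀ K ⊆ S ∪ T, IsPreconnected K → x ∈ K → y ∈ K → A ⊆ K := by
  have hSc := hS.compact.isClosed
  have hTc := hT.compact.isClosed
  have hvS : v ∈ S := (hST.ge rfl).1
  have hvT : v ∈ T := (hST.ge rfl).2
  have traceS : ∀ K ⊆ S ∪ T, IsPreconnected K → IsPreconnected (K ∩ S) := fun K h hK =>
    isPreconnected_inter_of_wedge hSc hTc hST hK h
  have traceT : ∀ K ⊆ S ∪ T, IsPreconnected K → IsPreconnected (K ∩ T) := fun K h hK =>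
    isPreconnected_inter_of_wedge hTc hSc (by rwa [inter_comm]) hK (by rwa [union_comm])
  by_cases hyS : y ∈ S
  · obtain ⟨A, hAS, hA, hmin⟩ := hS.arcs x hx y hyS hxy
    exact ⟨A, hAS.trans subset_union_left, hA, fun K hKS hK hxK hyK =>
      (hmin _ inter_subset_right (traceS K hKS hK) ⟨hxK, hx⟩ ⟨hyK, hyS⟩).trans inter_subset_left⟩
  have hyT := hy.resolve_left hyS
  obtain ⟨B, hBT, hB, hminB⟩ := hT.arcs v hvT y hyT fun h => hyS (h ▸ hvS)
  have hB' : ∀ K ⊆ S ∪ T, IsPreconnected K → x ∈ K → y ∈ K → v ∈ K ∧ B ⊆ K :=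
    fun K hKS hK hxK hyK => by
      have hv := mem_of_isPreconnected_of_wedge hSc hTc hST hK hKS ⟨x, hxK, hx⟩ ⟨y, hyK, hyT⟩
      exact ⟨hv, (hminB _ inter_subset_right (traceT K hKS hK) ⟨hv, hvT⟩ ⟨hyK, hyT⟩).trans
        inter_subset_left⟩
  by_cases hxv : x = v
  · subst hxv
    exact ⟨B, hBT.trans subset_union_right, hB, fun K h1 h2 h3 h4 => (hB' K h1 h2 h3 h4).2⟩
  · obtain ⟨A, hAS, hA, hmin⟩ := hS.arcs x hx v hvS hxv
    refine ⟨A ∪ B, union_subset_union hAS hBT, hA.trans hB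
      (hST ▸ inter_subset_inter hAS hBT), fun K hKS hK hxK hyK => ?_⟩
    obtain ⟨hv, hBK⟩ := hB' K hKS hK hxK hyK
    exact union_subset ((hmin _ inter_subset_right (traceS K hKS hK) ⟨hxK, hx⟩ ⟨hv, hvS⟩).trans
      inter_subset_left) hBK

theorem IsArcTree.union [T2Space Z] {S T : Set Z} {v : Z} (hS : IsArcTree S)
    (hT : IsArcTree T) (hST : S ∩ T = {v}) : IsArcTree (S ∪ T) where
  compact := hS.compact.union hT.compact
  nonempty := hS.nonempty.inl
  arcs := by
    intro x hx y hy hxy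
    rcases hx with hx | hx
    · exact hS.exists_arc_union hT hST hx hy hxy
    · rw [union_comm] at hy ⊢
      exact hT.exists_arc_union hS (by rwa [inter_comm]) hx hy hxy
  finite := by
    obtain ⟨𝒜, hfin, hA, rfl⟩ := hS.finite
    obtain ⟨ℬ, hfin', hB, rfl⟩ := hT.finite
    exact ⟨𝒜 ∪ ℬ, hfin.union hfin', fun A h => h.elim (hA A) (hB A), sUnion_union 𝒜 ℬ⟩

/-- Attaching finitely many pairwise disjoint trees, each at one point, gives a tree. -/
theorem IsArcTree.union_biUnion [T2Space Z] {ι : Type*} {S : Set Z} (hS : IsArcTree S)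
    {T : ι → Set Z} {v : ι → Z} {D : Set ι} (hD : D.Finite) (hT : ∀ d ∈ D, IsArcTree (T d))
    (hST : ∀ d ∈ D, S ∩ T d = {v d}) (hdisj : ∀ d ∈ D, ∀ e ∈ D, d ≠ e → Disjoint (T d) (T e)) :
    IsArcTree (S ∪ ⋃ d ∈ D, T d) := by
  induction D, hD using Set.Finite.induction_on with
  | empty => simpa using hS
  | @insert e D he _ ih =>
    have ih' := ih (fun d hd => hT d (.inr hd)) (fun d hd => hST d (.inr hd))
      (fun d hd d' hd' => hdisj d (.inr hd) d' (.inr hd'))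
    rw [biUnion_insert, union_comm (T e), ← union_assoc]
    refine ih'.union (v := v e) (hT e (.inl rfl)) ?_
    rw [union_inter_distrib_right, hST e (.inl rfl), iUnion₂_inter]
    refine union_eq_self_of_subset_right (iUnion₂_subset fun d hd => ?_)
    rw [(hdisj d (.inr hd) e (.inl rfl) fun h => he (h ▸ hd)).inter_eq]
    exact empty_subset _

theorem IsArcBetween.preimage_val {S A : Set Z} {x y : S} (h : IsArcBetween A (x : Z) y)
    (hA : A ⊆ S) : IsArcBetween ((↑) ⁻¹' A : Set S) x y := by
  obtain ⟨γ, hγ, h0, h1, rfl⟩ := h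
  refine ⟨fun t => ⟨γ t, hA (mem_range_self t)⟩, hγ.codRestrict S _, Subtype.ext h0,
    Subtype.ext h1, ?_⟩
  ext z
  simp [Subtype.ext_iff]

theorem IsArcBetween.image_val {S : Set Z} {A : Set S} {x y : S} (h : IsArcBetween A x y) :
    IsArcBetween ((↑) '' A : Set Z) (x : Z) y := by
  obtain ⟨γ, hγ, rfl, rfl, rfl⟩ := h
  exact ⟨Subtype.val ∘ γ, IsEmbedding.subtypeVal.comp hγ, rfl, rfl, range_comp _ _⟩

/-- The minimal arc lies in every arc with the same endpoints, hence equals it. Nontriviality lets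
each one-point piece be replaced by a genuine arc. -/
theorem IsArcTree.isTopTree [TopologicalSpace.MetrizableSpace Z] {S : Set Z} (hS : IsArcTree S)
    (hnt : S.Nontrivial) : IsTopTree S := by
  have harc : ∀ x : S, ∃ A : Set S, IsArc A ∧ x ∈ A := fun x => by
    obtain ⟨y, hy, hyx⟩ := hnt.exists_ne x
    obtain ⟨A, hAS, hA, -⟩ := hS.arcs x x.2 y hy hyx.symm
    exact ⟨Subtype.val ⁻¹' A, ⟨x, ⟨y, hy⟩, hA.preimage_val (x := x) (y := ⟨y, hy⟩) hAS⟩, hA.left_mem⟩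
  refine ⟨⟨isCompact_iff_compactSpace.1 hS.compact,
    isConnected_iff_connectedSpace.1 ⟨hS.nonempty, hS.isPreconnected⟩, inferInstance⟩, ?_, ?_⟩
  · obtain ⟨𝒜, hfin, hA, hU⟩ := hS.finite
    have : ∀ A ∈ 𝒜, ∃ B : Set S, IsArc B ∧ (↑) ⁻¹' A ⊆ B := by
      intro A hA'
      have hAS : A ⊆ S := (subset_sUnion_of_mem hA').trans hU.le
      rcases hA A hA' with ⟨x, y, h⟩ | ⟨x, rfl⟩
      · exact ⟨(↑) ⁻¹' A, ⟨⟨x, hAS h.left_mem⟩, ⟨y, hAS h.right_mem⟩,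
          h.preimage_val (x := ⟨x, hAS h.left_mem⟩) (y := ⟨y, hAS h.right_mem⟩) hAS⟩, le_rfl⟩
      · obtain ⟨B, hB, hxB⟩ := harc ⟨x, hAS rfl⟩
        refine ⟨B, hB, ?_⟩
        rintro z hz
        rwa [show z = ⟨x, hAS rfl⟩ from Subtype.ext hz]
    choose! B hB hAB using this
    refine ⟨B '' 𝒜, hfin.image B, by rintro _ ⟨A, h, rfl⟩; exact hB A h, ?_⟩
    refine eq_univ_of_forall fun z => ?_
    obtain ⟨A, hA', hz⟩ := hU.ge z.2
    exact ⟨B A, ⟨A, hA', rfl⟩, hAB A hA' hz⟩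
  · intro x y hxy
    obtain ⟨A, hAS, hA, hmin⟩ := hS.arcs x x.2 y y.2 fun h => hxy (Subtype.ext h)
    refine ⟨(↑) ⁻¹' A, hA.preimage_val hAS, fun B hB => ?_⟩
    have h1 : A = (↑) '' B := hA.eq_of_subset hB.image_val
      (hmin _ (by rintro _ ⟨z, -, rfl⟩; exact z.2) hB.image_val.isPreconnected
        hB.image_val.left_mem hB.image_val.right_mem)
    rw [h1, preimage_image_eq B Subtype.val_injective]

end ArcTree

/-! ### Inverse limits of trees -/

section Limit

variable {Y : Type*} [TopologicalSpace Y]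
  {Z : ℕ → Type*} [∀ k, TopologicalSpace (Z k)] [∀ k, T2Space (Z k)]

theorem eq_of_le_of_coherent {Y : Type*} {Z : ℕ → Type*} {P : ∀ k, Y → Z k}
    (hcoh : ∀ k x y, P (k + 1) x = P (k + 1) y → P k x = P k y) {j k : ℕ} (hjk : j ≤ k)
    {x y : Y} (h : P k x = P k y) : P j x = P j y := by
  induction k, hjk using Nat.le_induction with
  | base => exact h
  | succ k _ ih => exact ih (hcoh k x y h)

/-- If the images of two compact sets under a coherent, point-separating sequence of maps have
connected intersections, then the intersection of the sets is connected. -/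
theorem isPreconnected_inter_of_images [T2Space Y] {P : ∀ k, Y → Z k} (hP : ∀ k, Continuous (P k))
    (hcoh : ∀ k x y, P (k + 1) x = P (k + 1) y → P k x = P k y)
    (hsep : ∀ x y, (∀ k, P k x = P k y) → x = y) {A B : Set Y} (hA : IsCompact A)
    (hB : IsCompact B) (hAB : ∀ k, IsPreconnected (P k '' A ∩ P k '' B)) :
    IsPreconnected (A ∩ B) := by
  rw [isPreconnected_closed_iff]
  rintro U V hU hV hcov ⟨a, ha, haU⟩ ⟨b, hb, hbV⟩
  by_contra hempty
  have hdisj : Disjoint (A ∩ B ∩ U) (A ∩ B ∩ V) := by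
    rw [Set.disjoint_left]
    exact fun z hz1 hz2 => hempty ⟨z, hz1.1, hz1.2, hz2.2⟩
  have hcAB := hA.inter hB
  obtain ⟨U', V', hU', hV', hUU', hVV', hUV'⟩ :=
    SeparatedNhds.of_isCompact_isCompact (hcAB.inter_right hU) (hcAB.inter_right hV) hdisj
  -- These compact sets decrease to the diagonal of `A ∩ B`, so some `W k` already splits into a
  -- `U'` part and a `V'` part.
  let W : ℕ → Set (Y × Y) := fun k => (A ×ˢ B) ∩ {q | P k q.1 = P k q.2}
  have hWc : ∀ k, IsCompact (W k) := fun k => (hA.prod hB).inter_right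
    (isClosed_eq ((hP k).comp continuous_fst) ((hP k).comp continuous_snd))
  obtain ⟨k, hk⟩ : ∃ k, W k ⊆ U' ×ˢ U' ∪ V' ×ˢ V' := by
    refine exists_subset_nhds_of_isCompact (directed_of_isDirected_le ?_) hWc ?_
    · intro j k hjk q hq
      exact ⟨hq.1, eq_of_le_of_coherent hcoh hjk hq.2⟩
    · rintro ⟨x, y⟩ hxy
      rw [mem_iInter] at hxy
      obtain rfl : x = y := hsep x y fun k => (hxy k).2
      have hx : x ∈ A ∩ B := ⟨(hxy 0).1.1, (hxy 0).1.2⟩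
      refine ((hU'.prod hU').union (hV'.prod hV')).mem_nhds ?_
      rcases hcov hx with h | h
      · exact .inl ⟨hUU' ⟨hx, h⟩, hUU' ⟨hx, h⟩⟩
      · exact .inr ⟨hVV' ⟨hx, h⟩, hVV' ⟨hx, h⟩⟩
  have himage : ∀ {O O' : Set Y}, IsOpen O' → Disjoint O O' →
      W k ⊆ O ×ˢ O ∪ O' ×ˢ O' → IsClosed ((fun q : Y × Y => P k q.1) '' (W k \ O' ×ˢ O')) :=
    fun hO' _ _ => (((hWc k).diff (hO'.prod hO')).image ((hP k).comp continuous_fst)).isClosed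
  obtain ⟨w, -, ⟨q, hq, hqw⟩, ⟨r, hr, hrw⟩⟩ := isPreconnected_closed_iff.1 (hAB k) _ _
    (himage hV' hUV' hk) (himage hU' hUV'.symm (by rwa [union_comm]))
    (by
      rintro _ ⟨⟨x, hx, rfl⟩, ⟨y, hy, hxy⟩⟩
      have hW : (x, y) ∈ W k := ⟨⟨hx, hy⟩, hxy.symm⟩
      rcases hk hW with h | h
      · exact .inl ⟨(x, y), ⟨hW, fun h' => Set.disjoint_left.1 hUV' h.1 h'.1⟩, rfl⟩
      · exact .inr ⟨(x, y), ⟨hW, fun h' => Set.disjoint_left.1 hUV' h'.1 h.1⟩, rfl⟩)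
    ⟨P k a, ⟨⟨a, ha.1, rfl⟩, ⟨a, ha.2, rfl⟩⟩, (a, a), ⟨⟨⟨ha.1, ha.2⟩, rfl⟩,
      fun h => Set.disjoint_left.1 hUV' (hUU' ⟨ha, haU⟩) h.1⟩, rfl⟩
    ⟨P k b, ⟨⟨b, hb.1, rfl⟩, ⟨b, hb.2, rfl⟩⟩, (b, b), ⟨⟨⟨hb.1, hb.2⟩, rfl⟩,
      fun h => Set.disjoint_left.1 hUV' h.1 (hVV' ⟨hb, hbV⟩)⟩, rfl⟩
  have hq' := (hk hq.1).resolve_right hq.2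
  have hr' := (hk hr.1).resolve_left hr.2
  -- Connectedness gave `q` near `U` and `r` near `V` with the same image; the mixed pair then
  -- belongs to `W k` but to neither part.
  have hmix : (q.1, r.2) ∈ W k := ⟨⟨hq.1.1.1, hr.1.1.2⟩, by
    change P k q.1 = P k r.2
    rw [← hr.1.2]
    exact hqw.trans hrw.symm⟩
  rcases hk hmix with h | h
  · exact Set.disjoint_left.1 hUV' h.2 hr'.2
  · exact Set.disjoint_left.1 hUV' hq'.1 h.1

/-- A compact space is the inverse limit of its images under a coherent, point-separating sequence
of continuous maps. -/
theorem exists_homeomorph_invLim_range [CompactSpace Y] {P : ∀ k, Y → Z k} (hP : ∀ k, Continuous (P k))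
    (hcoh : ∀ k x y, P (k + 1) x = P (k + 1) y → P k x = P k y)
    (hsep : ∀ x y, (∀ k, P k x = P k y) → x = y) :
    ∃ g : ∀ k, range (P (k + 1)) → range (P k), (∀ k, Continuous (g k)) ∧
      Nonempty (Y ≃ₜ invLim (X := fun k => range (P k)) (fun k t => {g k t})) := by
  let R : ∀ k, Y → range (P k) := fun k => rangeFactorization (P k)
  have hR : ∀ k, Continuous (R k) := fun k => (hP k).subtype_mk _
  have hRs : ∀ k, Function.Surjective (R k) := fun k => rangeFactorization_surjective
  have hRP : ∀ k x y, R k x = R k y ↔ P k x = P k y := fun k x y => Subtype.ext_iff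
  let g : ∀ k, range (P (k + 1)) → range (P k) := fun k t => R k (hRs (k + 1) t).choose
  have hg : ∀ k x, g k (R (k + 1) x) = R k x := fun k x =>
    (hRP k _ _).2 (hcoh k _ _ ((hRP (k + 1) _ _).1 (hRs (k + 1) (R (k + 1) x)).choose_spec))
  have hgc : ∀ k, Continuous (g k) := fun k => by
    -- A continuous surjection from a compact space to a Hausdorff space is a quotient map, so
    -- continuity of `g k` can be tested after composing.
    have hq : IsQuotientMap (R (k + 1)) := (hR (k + 1)).isClosedMap.isQuotientMap (hR _) (hRs _)
    rw [hq.continuous_iff]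
    exact (hR k).congr fun x => (hg k x).symm
  refine ⟨g, hgc, ?_⟩
  let Θ : Y → invLim (X := fun k => range (P k)) (fun k t => {g k t}) := fun x =>
    ⟨fun k => R k x, fun k => (hg k x).symm⟩
  have hΘ : Continuous Θ := (continuous_pi hR).subtype_mk _
  have hinj : Function.Injective Θ := fun x y hxy => hsep x y fun k =>
    (hRP k x y).1 (congrFun (congrArg Subtype.val hxy) k)
  have hsurj : Function.Surjective Θ := by
    rintro ⟨t, ht⟩
    have hne : (⋂ k, R k ⁻¹' {t k}).Nonempty := by
      refine IsCompact.nonempty_iInter_of_sequence_nonempty_isCompact_isClosed _ ?_ ?_ ?_ ?_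
      · intro k x hx
        have h1 : t k = g k (t (k + 1)) := ht k
        have h2 : R (k + 1) x = t (k + 1) := hx
        change R k x = t k
        rw [h1, ← h2, hg]
      · exact fun k => hRs k (t k)
      · exact (isClosed_singleton.preimage (hR 0)).isCompact
      · exact fun k => isClosed_singleton.preimage (hR k)
    obtain ⟨x, hx⟩ := hne
    exact ⟨x, Subtype.ext (funext fun k => mem_iInter.1 hx k)⟩
  exact ⟨hΘ.homeoOfEquivCompactToT2 (f := Equiv.ofBijective Θ ⟨hinj, hsurj⟩)⟩

end Limit

theorem isTreeLike_and_isHereditarilyUnicoherent {Y : Type*} [TopologicalSpace Y] [CompactSpace Y]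
    [TopologicalSpace.MetrizableSpace Y] {Z : ℕ → Type} [∀ k, TopologicalSpace (Z k)]
    [∀ k, TopologicalSpace.MetrizableSpace (Z k)] {P : ∀ k, Y → Z k} (hP : ∀ k, Continuous (P k))
    (hcoh : ∀ k x y, P (k + 1) x = P (k + 1) y → P k x = P k y)
    (hsep : ∀ x y, (∀ k, P k x = P k y) → x = y) (htree : ∀ k, IsArcTree (range (P k)))
    (hnt : ∀ k, (range (P k)).Nontrivial) : IsTreeLike Y ∧ IsHereditarilyUnicoherent Y := by
  have hY : IsContinuum Y := by
    -- Connectedness of `Y` is the case `A = B = Y`.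
    have hpre := isPreconnected_inter_of_images hP hcoh hsep (isCompact_univ (X := Y))
      isCompact_univ fun k => by
        rw [inter_self, image_univ]
        exact (htree k).isPreconnected
    obtain ⟨_, y, -⟩ := (htree 0).nonempty
    rw [inter_self] at hpre
    exact ⟨inferInstance, { isPreconnected_univ := hpre, toNonempty := ⟨y⟩ }, inferInstance⟩
  refine ⟨⟨hY, ?_⟩, hY, fun K hK => ⟨hK, fun A B hA hB hAB => ⟨hA.1.inter hB.1, ?_, ?_⟩⟩⟩
  · obtain ⟨g, hg, hh⟩ := exists_homeomorph_invLim_range hP hcoh hsep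
    exact ⟨fun k => range (P k), fun k => inferInstance, g,
      fun k => (htree k).isTopTree (hnt k), hg, hh⟩
  · obtain ⟨z, -, hz⟩ := isPreconnected_closed_iff.1 hK.2.isPreconnected A B hA.1.isClosed
      hB.1.isClosed hAB.ge (hA.2.nonempty.mono fun a ha => ⟨hAB.le (.inl ha), ha⟩)
      (hB.2.nonempty.mono fun b hb => ⟨hAB.le (.inr hb), hb⟩)
    exact ⟨z, hz⟩
  · exact isPreconnected_inter_of_images hP hcoh hsep hA.1 hB.1 fun k =>
      (htree k).isPreconnected_inter (image_subset_range _ _) (image_subset_range _ _)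
        (hA.2.isPreconnected.image _ (hP k).continuousOn)
        (hB.2.isPreconnected.image _ (hP k).continuousOn)

/-! ### Monotone maps that collapse a nowhere dense set -/

/-- The primitive of `max 0 (dist (u, C) - ε)`, which is constant near each point of `C`. -/
noncomputable def collapse (C : Set ℝ) (ε t : ℝ) : ℝ :=
  ∫ u in (0 : ℝ)..t, max 0 (Metric.infDist u C - ε)

section Collapse

variable {C : Set ℝ} {ε δ a b : ℝ}

theorem continuous_collapse_integrand (C : Set ℝ) (ε : ℝ) :
    Continuous fun u : ℝ => max 0 (Metric.infDist u C - ε) :=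
  continuous_const.max ((Metric.continuous_infDist_pt C).sub continuous_const)

theorem collapse_sub (C : Set ℝ) (ε a b : ℝ) :
    collapse C ε b - collapse C ε a = ∫ u in a..b, max 0 (Metric.infDist u C - ε) :=
  intervalIntegral.integral_interval_sub_left
    ((continuous_collapse_integrand C ε).intervalIntegrable _ _)
    ((continuous_collapse_integrand C ε).intervalIntegrable _ _)

theorem continuous_collapse (C : Set ℝ) (ε : ℝ) : Continuous (collapse C ε) :=
  intervalIntegral.continuous_primitive
    (fun _ _ => (continuous_collapse_integrand C ε).intervalIntegrable _ _) 0

theorem monotone_collapse (C : Set ℝ) (ε : ℝ) : Monotone (collapse C ε) := by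
  intro a b hab
  rw [← sub_nonneg, collapse_sub]
  exact intervalIntegral.integral_nonneg hab fun u _ => le_max_left _ _

@[simp] theorem collapse_zero (C : Set ℝ) (ε : ℝ) : collapse C ε 0 = 0 :=
  intervalIntegral.integral_same

theorem collapse_lt_collapse {c : ℝ} (hab : a < b) (hc : c ∈ Icc a b)
    (h : ε < Metric.infDist c C) : collapse C ε a < collapse C ε b := by
  rw [← sub_pos, collapse_sub]
  exact intervalIntegral.integral_pos hab (continuous_collapse_integrand C ε).continuousOn
    (fun u _ => le_max_left _ _) ⟨c, hc, lt_max_of_lt_right (sub_pos.2 h)⟩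

/-- A smaller `ε` gives a larger nonnegative integrand, so its integral vanishing forces the other
to vanish. -/
theorem collapse_eq_of_le (hδ : δ ≤ ε) (h : collapse C δ a = collapse C δ b) :
    collapse C ε a = collapse C ε b := by
  wlog hab : a ≤ b generalizing a b
  · exact (this h.symm (le_of_not_ge hab)).symm
  refine le_antisymm (monotone_collapse C ε hab) ?_
  rw [← sub_nonpos, collapse_sub]
  rw [eq_comm, ← sub_eq_zero, collapse_sub] at h
  refine le_of_le_of_eq ?_ h
  exact intervalIntegral.integral_mono_on hab
    ((continuous_collapse_integrand C ε).intervalIntegrable _ _)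
    ((continuous_collapse_integrand C δ).intervalIntegrable _ _)
    fun u _ => max_le_max le_rfl (sub_le_sub_left hδ _)

theorem collapse_eq_of_dist_le {c t : ℝ} (hc : c ∈ C) (h : dist t c ≤ ε) :
    collapse C ε t = collapse C ε c := by
  rw [← sub_eq_zero, collapse_sub]
  refine (intervalIntegral.integral_congr (g := fun _ => 0) fun u hu => max_eq_left (sub_nonpos.2 ?_)).trans intervalIntegral.integral_zero
  refine (Metric.infDist_le_dist_of_mem hc).trans (le_trans ?_ h)
  rw [Real.dist_eq, Real.dist_eq]
  exact abs_sub_left_of_mem_uIcc hu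

/-- Finitely many `ε`-balls centred in `C` cover `C`, and the map is constant on each. -/
theorem finite_image_collapse (hC : IsCompact C) (hε : 0 < ε) : (collapse C ε '' C).Finite := by
  obtain ⟨t, htC, ht, hcov⟩ := hC.finite_cover_balls hε
  refine (ht.image (collapse C ε)).subset ?_
  rintro _ ⟨c, hc, rfl⟩
  obtain ⟨x, hx, hcx⟩ := mem_iUnion₂.1 (hcov hc)
  exact ⟨x, hx, (collapse_eq_of_dist_le (htC hx) (Metric.mem_ball.1 hcx).le).symm⟩

end Collapse

/-- A sequence of monotone maps of `[0,1]` that jointly separate points, each of which has finite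
image on a given closed nowhere dense set. -/
theorem exists_collapsing_sequence {C : Set I} (hC : IsClosed C) (hint : interior C = ∅)
    (hne : C.Nonempty) (h0 : (0 : I) ∉ C) :
    ∃ p : ℕ → I → ℝ, (∀ k, Continuous (p k)) ∧ (∀ k, Monotone (p k)) ∧ (∀ k, p k 0 = 0) ∧
      (∀ k, 0 < p k 1) ∧ (∀ k, (p k '' C).Finite) ∧
      (∀ k a b, p (k + 1) a = p (k + 1) b → p k a = p k b) ∧
      ∀ a b, (∀ k, p k a = p k b) → a = b := by
  have hCc : IsCompact ((↑) '' C : Set ℝ) := hC.isCompact.image continuous_subtype_val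
  have hpos : ∀ u : I, u ∉ C → 0 < Metric.infDist (u : ℝ) ((↑) '' C) := fun u hu =>
    (hCc.isClosed.notMem_iff_infDist_pos (hne.image _)).1 fun ⟨v, hv, hvu⟩ =>
      hu (Subtype.ext hvu ▸ hv)
  set δ := Metric.infDist ((0 : I) : ℝ) ((↑) '' C) with hδ
  have hδ0 : 0 < δ := hpos 0 h0
  -- The denominator `k + 2` keeps `ε` strictly below `δ`, so the integrand is positive at `0` and
  -- `p k 1 > 0`.
  refine ⟨fun k t => collapse ((↑) '' C) (δ / (k + 2)) t,
    fun k => (continuous_collapse _ _).comp continuous_subtype_val,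
    fun k a b hab => monotone_collapse _ _ hab, fun k => collapse_zero _ _, fun k => ?_,
    fun k => ?_, fun k a b hab => collapse_eq_of_le ?_ hab, fun a b hab => ?_⟩
  · have h := collapse_lt_collapse (C := (↑) '' C) (ε := δ / (k + 2)) (a := 0) (b := 1)
      (c := ((0 : I) : ℝ)) one_pos (by simp) (div_lt_self hδ0 (by linarith [k.cast_nonneg (α := ℝ)]))
    rwa [collapse_zero] at h
  · have := finite_image_collapse hCc (ε := δ / (k + 2)) (by positivity)
    rwa [image_image] at this
  · gcongr
    linarith
  · by_contra hne'
    wlog hlt : a < b generalizing a b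
    · exact this b a (fun k => (hab k).symm) (Ne.symm hne')
        (lt_of_le_of_ne (le_of_not_gt hlt) (Ne.symm hne'))
    obtain ⟨u, hu, huC⟩ : ∃ u ∈ Ioo a b, u ∉ C := by
      by_contra! hsub
      have : Ioo a b ⊆ interior C := interior_maximal hsub isOpen_Ioo
      rw [hint] at this
      exact (nonempty_Ioo.2 hlt).not_subset_empty this
    obtain ⟨k, hk⟩ := exists_nat_gt (δ / Metric.infDist (u : ℝ) ((↑) '' C))
    have hu0 := hpos u huC
    refine (collapse_lt_collapse (C := (↑) '' C) (ε := δ / (k + 2)) (a := a) (b := b) (c := u)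
      hlt ⟨hu.1.le, hu.2.le⟩ ?_).ne (hab k)
    rw [div_lt_iff₀ hu0] at hk
    rw [div_lt_iff₀ (by positivity)]
    nlinarith

/-! ### The finite trees -/

/-- The first `n + 1` coordinates of a sequence, mapped by `p`. -/
noncomputable def truncate (p : I → ℝ) (n : ℕ) (x : ℕ → I) : ℕ → ℝ :=
  fun i => if i ≤ n then p (x i) else 0

/-- The images under `p` of the sequences `(x 0, …, x n)` with `x n ≤ a` and
`x i ≤ s (x (i + 1))`. -/
def truncatedLimit (p : I → ℝ) (s : I → I) (n : ℕ) (a : I) : Set (ℕ → ℝ) :=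
  {y | ∃ x : ℕ → I, x n ≤ a ∧ (∀ i < n, x i ≤ s (x (i + 1))) ∧ truncate p n x = y}

section Truncate

variable {p : I → ℝ} {s : I → I}

theorem truncate_of_le {n i : ℕ} (h : i ≤ n) (x : ℕ → I) : truncate p n x i = p (x i) := if_pos h

theorem truncate_of_lt {n i : ℕ} (h : n < i) (x : ℕ → I) : truncate p n x i = 0 :=
  if_neg (not_le.2 h)

theorem truncate_succ (n : ℕ) (x : ℕ → I) :
    truncate p (n + 1) x = Function.update (truncate p n x) (n + 1) (p (x (n + 1))) := by
  ext i
  rcases lt_trichotomy i (n + 1) with h | rfl | h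
  · rw [Function.update_of_ne h.ne, truncate_of_le h.le, truncate_of_le (Nat.lt_succ_iff.1 h)]
  · rw [Function.update_self, truncate_of_le le_rfl]
  · rw [Function.update_of_ne h.ne', truncate_of_lt h, truncate_of_lt (by lia)]

theorem truncate_congr {n : ℕ} {x y : ℕ → I} (h : ∀ i ≤ n, x i = y i) :
    truncate p n x = truncate p n y := by
  ext i
  by_cases hi : i ≤ n
  · rw [truncate_of_le hi, truncate_of_le hi, h i hi]
  · rw [truncate_of_lt (not_le.1 hi), truncate_of_lt (not_le.1 hi)]

theorem truncate_eq_single (h0 : p 0 = 0) {n : ℕ} {x : ℕ → I} (hx : ∀ i < n, x i = 0) :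
    truncate p n x = Pi.single n (p (x n)) := by
  ext i
  rcases lt_trichotomy i n with h | rfl | h
  · rw [truncate_of_le h.le, hx i h, h0, Pi.single_eq_of_ne h.ne]
  · rw [Pi.single_eq_same, truncate_of_le le_rfl]
  · rw [truncate_of_lt h, Pi.single_eq_of_ne h.ne']

theorem isArcTree_single_image (n : ℕ) {v : ℝ} (hv : 0 ≤ v) :
    IsArcTree (Pi.single (M := fun _ => ℝ) n '' Icc 0 v) :=
  (isArcTree_Icc hv).image (continuous_const.update n continuous_id) (continuous_apply n)
    fun _ _ => Pi.single_eq_same n _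

theorem single_image_subset_truncatedLimit (hp : Continuous p) (h0 : p 0 = 0) (n : ℕ) (a : I) :
    Pi.single (M := fun _ => ℝ) n '' Icc 0 (p a) ⊆ truncatedLimit p s n a := by
  rintro _ ⟨v, hv, rfl⟩
  rw [← h0] at hv
  obtain ⟨t, ht, rfl⟩ := intermediate_value_Icc nonneg' hp.continuousOn hv
  refine ⟨Pi.single n t, by simpa using ht.2, fun i hi => ?_, ?_⟩
  · rw [Pi.single_eq_of_ne hi.ne]
    exact nonneg'
  · rw [truncate_eq_single h0 fun i hi => Pi.single_eq_of_ne hi.ne _, Pi.single_eq_same]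

theorem truncatedLimit_zero (hp : Continuous p) (hm : Monotone p) (h0 : p 0 = 0) (a : I) :
    truncatedLimit p s 0 a = Pi.single (M := fun _ => ℝ) 0 '' Icc 0 (p a) := by
  refine Subset.antisymm ?_ (single_image_subset_truncatedLimit hp h0 0 a)
  rintro _ ⟨x, hx, -, rfl⟩
  exact ⟨p (x 0), ⟨h0 ▸ hm nonneg', hm hx⟩, (truncate_eq_single h0 (by simp)).symm⟩

theorem eq_zero_of_le {x : ℕ → I} {n : ℕ} (hs0 : s 0 = 0)
    (hx : ∀ i < n, x i ≤ s (x (i + 1))) (hn : x n = 0) : ∀ i ≤ n, x i = 0 := by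
  intro i hi
  induction hi using Nat.decreasingInduction with
  | self => exact hn
  | of_succ k hk ih => exact le_antisymm (by simpa [ih, hs0] using hx k hk) nonneg'

/-- `truncatedLimit p s (n + 1) a` is an arc with finitely many smaller trees attached to it. -/
theorem truncatedLimit_succ {C : Set I} (hp : Continuous p) (hm : Monotone p) (h0 : p 0 = 0)
    (hs : ∀ t ∉ C, s t = 0) (hC0 : (0 : I) ∉ C) (n : ℕ) (a : I) {τ : ℝ → I}
    (hτ : ∀ d ∈ p '' (C ∩ Iic a), τ d ≤ a ∧ p (τ d) = d ∧
      ∀ t ≤ a, p t = d → s t ≤ s (τ d)) :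
    truncatedLimit p s (n + 1) a = Pi.single (M := fun _ => ℝ) (n + 1) '' Icc 0 (p a) ∪
      ⋃ d ∈ p '' (C ∩ Iic a),
        (fun y => Function.update y (n + 1) d) '' truncatedLimit p s n (s (τ d)) := by
  refine Subset.antisymm ?_ (union_subset (single_image_subset_truncatedLimit hp h0 _ a)
    (iUnion₂_subset fun d hd => ?_))
  · rintro _ ⟨x, hxa, hx, rfl⟩
    by_cases hxC : x (n + 1) ∈ C
    · have hd : p (x (n + 1)) ∈ p '' (C ∩ Iic a) := ⟨_, ⟨hxC, hxa⟩, rfl⟩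
      refine .inr (mem_iUnion₂.2 ⟨_, hd, truncate p n x, ⟨x, ?_, fun i hi => hx i (by lia), rfl⟩,
        (truncate_succ n x).symm⟩)
      -- `τ d` maximises `s` on the fibre over `d`, so its tree contains those of all other points
      -- of the fibre.
      exact (hx n n.lt_succ_self).trans ((hτ _ hd).2.2 _ hxa rfl)
    -- Off `C` the height is zero, which kills all lower coordinates and leaves a point of the base
    -- arc.
    · have hn : x n = 0 := le_antisymm (hs _ hxC ▸ hx n n.lt_succ_self) nonneg'
      have hz := eq_zero_of_le (hs 0 hC0) (fun i (hi : i < n) => hx i (by lia)) hn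
      refine .inl ⟨p (x (n + 1)), ⟨h0 ▸ hm nonneg', hm hxa⟩, ?_⟩
      exact (truncate_eq_single h0 fun i hi => hz i (Nat.lt_succ_iff.1 hi)).symm
  · rintro _ ⟨_, ⟨x, hxa, hx, rfl⟩, rfl⟩
    obtain ⟨hτa, hτp, -⟩ := hτ d hd
    have hne : ∀ i ≤ n, Function.update x (n + 1) (τ d) i = x i := fun i hi =>
      Function.update_of_ne (by lia) _ _
    refine ⟨Function.update x (n + 1) (τ d), by simpa using hτa, fun i hi => ?_, ?_⟩
    · rcases (Nat.lt_succ_iff.1 hi).eq_or_lt with rfl | hi'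
      · simpa using hxa
      · rw [hne i hi'.le, hne (i + 1) hi']
        exact hx i hi'
    · rw [truncate_succ, Function.update_self, hτp, truncate_congr hne]

/-- Induction on the number of coordinates. Upper semicontinuity on the compact fibres of `p` in
`Iic a` supplies the maximisers `τ`; the attached trees are disjoint because coordinate `n + 1`
equals `d` on the tree over `d`. -/
theorem isArcTree_truncatedLimit {C : Set I} (hp : Continuous p) (hm : Monotone p) (h0 : p 0 = 0)
    (hfin : (p '' C).Finite) (husc : UpperSemicontinuous s) (hs : ∀ t ∉ C, s t = 0)
    (hC0 : (0 : I) ∉ C) (n : ℕ) (a : I) : IsArcTree (truncatedLimit p s n a) := by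
  have hp0 : ∀ t, 0 ≤ p t := fun t => h0 ▸ hm nonneg'
  induction n generalizing a with
  | zero =>
    rw [truncatedLimit_zero hp hm h0]
    exact isArcTree_single_image 0 (hp0 a)
  | succ n ih =>
    have : ∀ d ∈ p '' (C ∩ Iic a), ∃ t ≤ a, p t = d ∧ ∀ t' ≤ a, p t' = d → s t' ≤ s t := by
      rintro d ⟨c, ⟨-, hca⟩, hcd⟩
      obtain ⟨t, ⟨hta, htd⟩, ht⟩ := UpperSemicontinuousOn.exists_isMaxOn
        (s := Iic a ∩ p ⁻¹' {d}) ⟨c, hca, hcd⟩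
        (isClosed_Iic.inter (isClosed_singleton.preimage hp)).isCompact
        (husc.upperSemicontinuousOn _)
      exact ⟨t, hta, htd, fun t' h1 h2 => ht ⟨h1, h2⟩⟩
    choose! τ hτ using this
    rw [truncatedLimit_succ hp hm h0 hs hC0 n a hτ]
    -- Coordinate `n + 1` holds the padding value `0`, so resetting it to `0` undoes the translation
    -- to height `d`.
    have hsucc : ∀ m, ∀ y ∈ truncatedLimit p s n m, y (n + 1) = 0 := by
      rintro m _ ⟨x, -, -, rfl⟩
      exact truncate_of_lt n.lt_succ_self x
    refine (isArcTree_single_image (n + 1) (hp0 a)).union_biUnion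
      (v := fun d => Pi.single (n + 1) d) (hfin.subset (image_mono inter_subset_left)) ?_ ?_ ?_
    · intro d _
      refine (ih (s (τ d))).image (ψ := fun y => Function.update y (n + 1) 0)
        (continuous_id.update _ continuous_const) (continuous_id.update _ continuous_const) ?_
      intro y hy
      rw [Function.update_idem, ← hsucc _ y hy, Function.update_eq_self]
    · rintro d ⟨c, ⟨-, hca⟩, rfl⟩
      refine Subset.antisymm ?_ (singleton_subset_iff.2 ⟨⟨_, ⟨hp0 c, hm hca⟩, rfl⟩, 0, ?_, rfl⟩)
      · rintro _ ⟨⟨v, -, rfl⟩, y, -, hy⟩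
        have := congrFun hy (n + 1)
        simp only [Function.update_self, Pi.single_eq_same] at this
        rw [this, mem_singleton_iff]
      · exact single_image_subset_truncatedLimit hp h0 _ _
          ⟨0, ⟨le_rfl, hp0 _⟩, Pi.single_zero n⟩
    · intro d _ e _ hde
      rw [Set.disjoint_left]
      rintro _ ⟨y, -, rfl⟩ ⟨z, -, hz⟩
      have := congrFun hz (n + 1)
      simp only [Function.update_self] at this
      exact hde this.symm

end Truncate

/-! ### The bonding function -/

section HairHeight

variable {C : Icc (0 : ℚ) 1 → Set I}

theorem sSup_mem_unitInterval (C : Icc (0 : ℚ) 1 → Set I) (t : I) :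
    sSup ((fun r : Icc (0 : ℚ) 1 => ((r : ℚ) : ℝ)) '' {r | t ∈ C r}) ∈ I := by
  refine ⟨Real.sSup_nonneg ?_, Real.sSup_le ?_ zero_le_one⟩ <;> rintro _ ⟨r, -, rfl⟩
  · exact Rat.cast_nonneg.2 r.2.1
  · exact (Rat.cast_le.2 r.2.2).trans_eq Rat.cast_one

/-- The supremum of the indices `r` with `t ∈ C r`. -/
noncomputable def hairHeight (C : Icc (0 : ℚ) 1 → Set I) (t : I) : I :=
  ⟨_, sSup_mem_unitInterval C t⟩

theorem le_hairHeight_of_mem {r : Icc (0 : ℚ) 1} {t : I} (h : t ∈ C r) :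
    ((r : ℚ) : ℝ) ≤ hairHeight C t := by
  refine le_csSup ⟨1, ?_⟩ ⟨r, h, rfl⟩
  rintro _ ⟨r, -, rfl⟩
  exact (Rat.cast_le.2 r.2.2).trans_eq Rat.cast_one

theorem IsNestedCantorFamily.antitone (hC : IsNestedCantorFamily C) : Antitone C := by
  intro r r' h
  rcases h.eq_or_lt with rfl | h
  · exact le_rfl
  · exact (hC.2 r' r h).1.subset

theorem IsNestedCantorFamily.isClosed (hC : IsNestedCantorFamily C) (r : Icc (0 : ℚ) 1) :
    IsClosed (C r) :=
  (hC.1 r).1.1.closed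

theorem IsNestedCantorFamily.interior_eq_empty (hC : IsNestedCantorFamily C)
    (r : Icc (0 : ℚ) 1) : interior (C r) = ∅ :=
  (hC.isClosed r).isNowhereDense_iff.1 (hC.1 r).1.2

theorem IsNestedCantorFamily.zero_notMem (hC : IsNestedCantorFamily C) (r : Icc (0 : ℚ) 1) :
    (0 : I) ∉ C r := fun h => lt_irrefl _ ((hC.1 r).2 h).1

/-- The empty set is perfect, so nonemptiness comes from the strict inclusion `C 1 ⊂ C r`. -/
theorem IsNestedCantorFamily.nonempty (hC : IsNestedCantorFamily C) {r : Icc (0 : ℚ) 1}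
    (hr : r < 1) : (C r).Nonempty := by
  obtain ⟨t, ht, -⟩ := exists_of_ssubset (hC.2 1 r hr).1
  exact ⟨t, ht⟩

theorem zero_lt_one_index : (0 : Icc (0 : ℚ) 1) < 1 := Subtype.mk_lt_mk.2 one_pos

/-- Testing only levels strictly below `y` avoids asking whether the supremum is attained, and
exhibits the region under the graph as an intersection of closed sets. -/
theorem le_hairHeight_iff (hC : Antitone C) {y t : I} :
    y ≤ hairHeight C t ↔ ∀ r : Icc (0 : ℚ) 1, ((r : ℚ) : ℝ) < y → t ∈ C r := by
  constructor
  · intro hy r hr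
    have hlt : ((r : ℚ) : ℝ) < hairHeight C t := hr.trans_le hy
    have hne : ((fun r : Icc (0 : ℚ) 1 => ((r : ℚ) : ℝ)) '' {r | t ∈ C r}).Nonempty := by
      rw [nonempty_iff_ne_empty]
      intro hemp
      have h0 : (hairHeight C t : ℝ) = 0 := by
        change sSup _ = 0
        rw [hemp, Real.sSup_empty]
      rw [h0] at hlt
      exact absurd r.2.1 (not_le.2 (by exact_mod_cast hlt))
    obtain ⟨_, ⟨r', hr', rfl⟩, hrr'⟩ := exists_lt_of_lt_csSup hne hlt
    refine hC ?_ hr'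
    exact (Rat.cast_lt.1 hrr').le
  · intro h
    by_contra hlt
    obtain ⟨q, hq1, hq2⟩ := exists_rat_btwn (show (hairHeight C t : ℝ) < y from not_le.1 hlt)
    have hq0 : (0 : ℝ) ≤ q := (hairHeight C t).2.1.trans hq1.le
    have hq1' : (q : ℝ) ≤ 1 := hq2.le.trans y.2.2
    exact not_lt.2 (le_hairHeight_of_mem
      (h ⟨q, by exact_mod_cast hq0, by exact_mod_cast hq1'⟩ hq2)) hq1

theorem isClosed_le_hairHeight (hC : IsNestedCantorFamily C) :
    IsClosed {q : I × I | q.2 ≤ hairHeight C q.1} := by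
  simp only [le_hairHeight_iff hC.antitone, ofPred_forall, imp_iff_not_or, not_lt, ofPred_or]
  exact isClosed_iInter fun r => (isClosed_le (by fun_prop) continuous_const).union
    ((hC.isClosed r).preimage continuous_fst)

theorem upperSemicontinuous_hairHeight (hC : IsNestedCantorFamily C) :
    UpperSemicontinuous (hairHeight C) :=
  upperSemicontinuous_iff_isClosed_preimage.2 fun y =>
    (isClosed_le_hairHeight hC).preimage (f := fun t => (t, y)) (by fun_prop)

theorem hairHeight_eq_zero (hC : IsNestedCantorFamily C) {t : I} (ht : t ∉ C 0) :
    hairHeight C t = 0 := by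
  by_contra hne
  refine ht ((le_hairHeight_iff hC.antitone).1 le_rfl 0 ?_)
  have : 0 < hairHeight C t := unitInterval.pos_iff_ne_zero.2 hne
  simpa using this

/-- An upper semicontinuous function attains its maximum on `[0,1]`, and this is at least every
rational `q < 1` because `C q` is nonempty. -/
theorem exists_hairHeight_eq_one (hC : IsNestedCantorFamily C) : ∃ c, hairHeight C c = 1 := by
  obtain ⟨c, -, hc⟩ := UpperSemicontinuousOn.exists_isMaxOn univ_nonempty isCompact_univ
    ((upperSemicontinuous_hairHeight hC).upperSemicontinuousOn univ)
  refine ⟨c, le_antisymm le_one' ?_⟩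
  by_contra hlt
  obtain ⟨q, hq1, hq2⟩ := exists_rat_btwn (show (hairHeight C c : ℝ) < 1 from not_le.1 hlt)
  have hq0 : (0 : ℝ) ≤ q := (hairHeight C c).2.1.trans hq1.le
  have hq2' : q < 1 := by exact_mod_cast hq2
  obtain ⟨t, ht⟩ := hC.nonempty (r := ⟨q, by exact_mod_cast hq0, hq2'.le⟩) hq2'
  exact not_lt.2 ((le_hairHeight_of_mem ht).trans (hc (mem_univ t))) hq1

theorem mem_of_hairHeight_pos (hC : IsNestedCantorFamily C) {t : I} (h : 0 < hairHeight C t) :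
    t ∈ C 0 := by
  by_contra ht
  exact h.ne' (hairHeight_eq_zero hC ht)

end HairHeight

/-! ### The inverse limit -/

section LimX

variable {C : Icc (0 : ℚ) 1 → Set I} {f : I → I}

theorem mem_bondF_of_mem {t y : I} (ht : t ∈ C 0) : y ∈ bondF C f t ↔ y ≤ hairHeight C t := by
  rw [bondF, if_pos ht]
  rfl

theorem mem_bondF_of_notMem {t y : I} (ht : t ∉ C 0) : y ∈ bondF C f t ↔ y = f t := by
  rw [bondF, if_neg ht]
  rfl

/-- Since `f = 0` on `C 0`, the graph of `f` can be added over `C 0` too; the graph of `F` becomes a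
union of two closed sets. -/
theorem mem_bondF_iff (hf : IsBaseMap C f) {t y : I} :
    y ∈ bondF C f t ↔ (t ∈ C 0 ∧ y ≤ hairHeight C t) ∨ y = f t := by
  by_cases ht : t ∈ C 0
  · rw [mem_bondF_of_mem ht]
    refine ⟨fun h => .inl ⟨ht, h⟩, ?_⟩
    rintro (h | rfl)
    · exact h.2
    · rw [hf.2.1 t (.inr ht)]
      exact nonneg'
  · simp [mem_bondF_of_notMem ht, ht]

theorem isClosed_limX (hC : IsNestedCantorFamily C) (hf : IsBaseMap C f) :
    IsClosed (limX C f) := by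
  have : limX C f = ⋂ i : ℕ, {x | (x (i + 1) ∈ C 0 ∧ x i ≤ hairHeight C (x (i + 1))) ∨
      x i = f (x (i + 1))} := by
    ext x
    simp only [limX, invLim, mem_ofPred_eq, mem_iInter, mem_bondF_iff hf]
  rw [this]
  refine isClosed_iInter fun i => IsClosed.union (.inter ?_ ?_) ?_
  · exact (hC.isClosed 0).preimage (continuous_apply (i + 1))
  · exact (isClosed_le_hairHeight hC).preimage (f := fun x : ℕ → I => (x (i + 1), x i))
      (by fun_prop)
  · exact isClosed_eq (by fun_prop) (hf.1.comp (continuous_apply (i + 1)))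

/-! ### Coordinates in `C 0` and straightening -/

theorem IsBaseMap.notMem (hf : IsBaseMap C f) (t : I) : f t ∉ C 0 := fun h =>
  lt_irrefl _ (hf.2.2.1 t _ h)

theorem IsBaseMap.le_self (hf : IsBaseMap C f) (t : I) : f t ≤ t := by
  rcases (nonneg' : 0 ≤ t).eq_or_lt with rfl | h
  · rw [hf.2.1 0 (.inl rfl)]
  · exact (hf.2.2.2 t ⟨h, le_one'⟩).le

theorem mem_succ_of_mem (hf : IsBaseMap C f) {x : ℕ → I} (hx : x ∈ limX C f) {i : ℕ}
    (h : x i ∈ C 0) : x (i + 1) ∈ C 0 := by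
  by_contra hi
  exact hf.notMem _ ((mem_bondF_of_notMem hi).1 (hx i) ▸ h)

/-- The sequence increases, and its limit is a fixed point of `f`, hence `0`. -/
theorem eq_zero_of_forall_eq (hf : IsBaseMap C f) {x : ℕ → I} (hx : ∀ i, x i = f (x (i + 1)))
    (i : ℕ) : x i = 0 := by
  have hmono : Monotone x := monotone_nat_of_le_succ fun i => (hx i).trans_le (hf.le_self _)
  have hlim := tendsto_atTop_iSup hmono
  have hfix : ⨆ i, x i = f (⨆ i, x i) := by
    refine tendsto_nhds_unique hlim ?_
    exact ((hf.1.tendsto _).comp (hlim.comp (Filter.tendsto_add_atTop_nat 1))).congr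
      fun i => (hx i).symm
  have h0 : ⨆ i, x i = 0 := by
    by_contra hne
    exact (hf.2.2.2 _ ⟨unitInterval.pos_iff_ne_zero.2 hne, le_one'⟩).ne hfix.symm
  exact le_antisymm (h0 ▸ le_iSup x i) nonneg'

open scoped Classical in
/-- The map that replaces every coordinate `x i = f (x (i + 1))` with `x (i + 1) ∉ C 0` by `0`. -/
noncomputable def straighten (C : Icc (0 : ℚ) 1 → Set I) (x : ℕ → I) (i : ℕ) : I :=
  if x (i + 1) ∈ C 0 then x i else 0

theorem straighten_of_mem {x : ℕ → I} {i : ℕ} (h : x (i + 1) ∈ C 0) :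
    straighten C x i = x i := if_pos h

theorem straighten_of_notMem {x : ℕ → I} {i : ℕ} (h : x (i + 1) ∉ C 0) :
    straighten C x i = 0 := if_neg h

theorem continuous_straighten (hC : IsNestedCantorFamily C) (hf : IsBaseMap C f) :
    Continuous fun x : limX C f => straighten C (x : ℕ → I) := by
  classical
  refine continuous_pi fun i => ?_
  have hclosed : IsClosed {x : limX C f | x.1 (i + 1) ∈ C 0} :=
    (hC.isClosed 0).preimage ((continuous_apply (i + 1)).comp continuous_subtype_val)
  refine Continuous.if ?_ ((continuous_apply i).comp continuous_subtype_val) continuous_const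
  intro x hx
  have hxC : x.1 (i + 1) ∈ C 0 := hclosed.frontier_subset hx
  have hcl : IsClosed {x : limX C f | x.1 i = f (x.1 (i + 1))} :=
    isClosed_eq ((continuous_apply i).comp continuous_subtype_val)
      (hf.1.comp ((continuous_apply (i + 1)).comp continuous_subtype_val))
  rw [frontier_eq_closure_inter_closure] at hx
  -- A frontier point is a limit of points with `x i = f (x (i + 1))`, so there `x i = 0` and the
  -- two branches agree.
  have : x.1 i = f (x.1 (i + 1)) :=
    closure_minimal (fun y hy => (mem_bondF_of_notMem hy).1 (y.2 i)) hcl hx.2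
  rw [this]
  exact hf.2.1 _ (.inr hxC)

theorem straighten_mem_iff (hC : IsNestedCantorFamily C) (hf : IsBaseMap C f) {x : ℕ → I}
    (hx : x ∈ limX C f) (i : ℕ) : straighten C x i ∈ C 0 ↔ x i ∈ C 0 := by
  by_cases h : x (i + 1) ∈ C 0
  · rw [straighten_of_mem h]
  · rw [straighten_of_notMem h]
    exact iff_of_false (hC.zero_notMem 0) fun h' => h (mem_succ_of_mem hf hx h')

theorem straighten_eq_of_mem (hf : IsBaseMap C f) {x : ℕ → I} (hx : x ∈ limX C f) {i : ℕ}
    (h : x i ∈ C 0) : straighten C x i = x i :=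
  straighten_of_mem (mem_succ_of_mem hf hx h)

/-- The straightened sequence shows which coordinates lie in `C 0` and their values. From any such
coordinate the earlier ones are recovered downwards; if there is none, the point is zero. -/
theorem straighten_injOn (hC : IsNestedCantorFamily C) (hf : IsBaseMap C f) :
    InjOn (straighten C) (limX C f) := by
  intro x hx y hy hxy
  have hiff : ∀ i, x i ∈ C 0 ↔ y i ∈ C 0 := fun i => by
    rw [← straighten_mem_iff hC hf hx, hxy, straighten_mem_iff hC hf hy]
  have heq : ∀ i, x i ∈ C 0 → x i = y i := fun i hi => by
    rw [← straighten_eq_of_mem hf hx hi, hxy, straighten_eq_of_mem hf hy ((hiff i).1 hi)]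
  have hstep : ∀ i, x (i + 1) = y (i + 1) → x i = y i := fun i hi => by
    by_cases h : x (i + 1) ∈ C 0
    · rw [← straighten_of_mem h, hxy, straighten_of_mem ((hiff _).1 h)]
    · rw [(mem_bondF_of_notMem h).1 (hx i), hi,
        (mem_bondF_of_notMem fun h' => h ((hiff _).2 h')).1 (hy i)]
  by_cases hex : ∃ n, x n ∈ C 0
  · obtain ⟨n, hn⟩ := hex
    have hmem : ∀ m, n ≤ m → x m ∈ C 0 := fun m hm => by
      induction m, hm using Nat.le_induction with
      | base => exact hn
      | succ m _ ih => exact mem_succ_of_mem hf hx ih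
    have hdown : ∀ j i, x (i + j) = y (i + j) → x i = y i := fun j => by
      induction j with
      | zero => exact fun i h => h
      | succ j ih => exact fun i h => ih i (hstep (i + j) h)
    exact funext fun i => hdown n i (heq _ (hmem _ (Nat.le_add_left n i)))
  · push Not at hex
    have hx0 := eq_zero_of_forall_eq hf fun i => (mem_bondF_of_notMem (hex (i + 1))).1 (hx i)
    have hy0 := eq_zero_of_forall_eq hf fun i =>
      (mem_bondF_of_notMem fun h => hex (i + 1) ((hiff _).2 h)).1 (hy i)
    exact funext fun i => (hx0 i).trans (hy0 i).symm

theorem straighten_le (hf : IsBaseMap C f) {x : ℕ → I}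
    (hx : x ∈ limX C f) (i : ℕ) : straighten C x i ≤ hairHeight C (straighten C x (i + 1)) := by
  by_cases h : x (i + 1) ∈ C 0
  · rw [straighten_of_mem h, straighten_eq_of_mem hf hx h]
    exact (mem_bondF_of_mem h).1 (hx i)
  · rw [straighten_of_notMem h]
    exact nonneg'

/-- Induction on the place from which `z` stays in `C 0`: lift the shifted sequence, then prepend
one coordinate. -/
theorem exists_straighten_eq (hC : IsNestedCantorFamily C) (hf : IsBaseMap C f) (n : ℕ) :
    ∀ z : ℕ → I, (∀ i, z i ≤ hairHeight C (z (i + 1))) → (∀ i ≥ n, z i ∈ C 0) →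
      ∃ x ∈ limX C f, straighten C x = z := by
  classical
  induction n with
  | zero =>
    intro z hz hzC
    exact ⟨z, fun i => (mem_bondF_of_mem (hzC _ (Nat.zero_le _))).2 (hz i),
      funext fun i => straighten_of_mem (hzC _ (Nat.zero_le _))⟩
  | succ n ih =>
    intro z hz hzC
    obtain ⟨x, hx, hxz⟩ := ih (fun i => z (i + 1)) (fun i => hz (i + 1))
      fun i hi => hzC (i + 1) (Nat.succ_le_succ hi)
    -- Over `C 0` the new coordinate may be `z 0` itself; off `C 0` it must be `f (x 0)`, and then
    -- `z 0 = 0` because the height at `z 1` vanishes.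
    let w : ℕ → I := fun i => Nat.casesOn i (if x 0 ∈ C 0 then z 0 else f (x 0)) x
    have hw : ∀ i, w (i + 1) = x i := fun _ => rfl
    have hz1 : straighten C x 0 = z 1 := congrFun hxz 0
    refine ⟨w, fun i => ?_, funext fun i => ?_⟩
    · cases i with
      | zero =>
        change (if x 0 ∈ C 0 then z 0 else f (x 0)) ∈ bondF C f (x 0)
        by_cases h : x 0 ∈ C 0
        · rw [if_pos h, mem_bondF_of_mem h, ← straighten_eq_of_mem hf hx h, hz1]
          exact hz 0
        · rw [if_neg h, mem_bondF_of_notMem h]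
      | succ i => exact hx i
    · cases i with
      | zero =>
        by_cases h : x 0 ∈ C 0
        · rw [straighten_of_mem (show w (0 + 1) ∈ C 0 from h)]
          exact if_pos h
        · rw [straighten_of_notMem (show w (0 + 1) ∉ C 0 from h)]
          have h1 : z 1 ∉ C 0 := by rwa [← hz1, straighten_mem_iff hC hf hx]
          exact (le_antisymm (hairHeight_eq_zero hC h1 ▸ hz 0) nonneg').symm
      | succ i => exact congrFun hxz i

/-- The maps of the inverse limit to the finite trees have these trees as their ranges. -/
theorem range_truncate_straighten (hC : IsNestedCantorFamily C) (hf : IsBaseMap C f) (p : I → ℝ)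
    (n : ℕ) : range (fun x : limX C f => truncate p n (straighten C (x : ℕ → I))) =
      truncatedLimit p (hairHeight C) n 1 := by
  refine Subset.antisymm ?_ ?_
  · rintro _ ⟨x, rfl⟩
    exact ⟨straighten C x, le_one', fun i _ => straighten_le hf x.2 i, rfl⟩
  · rintro _ ⟨x, -, hx, rfl⟩
    obtain ⟨c, hc⟩ := exists_hairHeight_eq_one hC
    have hcC : c ∈ C 0 := mem_of_hairHeight_pos hC (hc ▸ unitInterval.pos_iff_ne_zero.2 one_ne_zero)
    -- Continuing with `c`, of height `1`, puts no constraint on `x n` and keeps all later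
    -- coordinates in `C 0`.
    let z : ℕ → I := fun i => if i ≤ n then x i else c
    have hzx : ∀ i ≤ n, z i = x i := fun i hi => if_pos hi
    have hzc : ∀ i, n < i → z i = c := fun i hi => if_neg (not_le.2 hi)
    obtain ⟨w, hw, hwz⟩ := exists_straighten_eq hC hf (n + 1) z (fun i => by
      rcases lt_or_ge i n with hi | hi
      · rw [hzx i hi.le, hzx (i + 1) hi]
        exact hx i hi
      · rw [hzc (i + 1) (Nat.lt_succ_iff.2 hi), hc]
        exact le_one') fun i hi => by rwa [hzc i hi]
    exact ⟨⟨w, hw⟩, by simp only [hwz]; exact truncate_congr hzx⟩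

theorem continuous_truncate {p : I → ℝ} (hp : Continuous p) (n : ℕ) :
    Continuous (truncate p n) := by
  refine continuous_pi fun i => ?_
  by_cases hi : i ≤ n
  · simp only [truncate_of_le hi]
    exact hp.comp (continuous_apply i)
  · simp only [truncate_of_lt (not_le.1 hi)]
    exact continuous_const

end LimX

end TreeLikeLimit

/-! ### Proof of the proposition -/

theorem mainTheorem6 (C : Set.Icc (0 : ℚ) 1 → Set unitInterval)
    (hC : TreeLikeLimit.IsNestedCantorFamily C)
    (f : unitInterval → unitInterval) (hf : TreeLikeLimit.IsBaseMap C f) :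
    TreeLikeLimit.IsTreeLike (TreeLikeLimit.limX C f) ∧
      TreeLikeLimit.IsHereditarilyUnicoherent (TreeLikeLimit.limX C f) := by
  open TreeLikeLimit in
  obtain ⟨p, hp, hm, hp0, hp1, hfin, hcoh, hsep⟩ := exists_collapsing_sequence (hC.isClosed 0)
    (hC.interior_eq_empty 0) (hC.nonempty zero_lt_one_index) (hC.zero_notMem 0)
  have : CompactSpace (limX C f) := isCompact_iff_compactSpace.1 (isClosed_limX hC hf).isCompact
  have heq : ∀ {k i : ℕ} {x y : ℕ → I}, i ≤ k → truncate (p k) k x = truncate (p k) k y →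
      p k (x i) = p k (y i) := fun hi h => by
    rw [← truncate_of_le (p := p _) hi, h, truncate_of_le hi]
  refine isTreeLike_and_isHereditarilyUnicoherent (Z := fun _ => ℕ → ℝ)
    (P := fun k x => truncate (p k) k (straighten C (x : ℕ → I)))
    (fun k => (continuous_truncate (hp k) k).comp (continuous_straighten hC hf)) ?_ ?_ ?_ ?_
  · intro k x y hxy
    ext i
    by_cases hi : i ≤ k
    · rw [truncate_of_le hi, truncate_of_le hi]
      exact hcoh k _ _ (heq (hi.trans k.le_succ) hxy)
    · rw [truncate_of_lt (not_le.1 hi), truncate_of_lt (not_le.1 hi)]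
  · intro x y hxy
    refine Subtype.ext (straighten_injOn hC hf x.2 y.2 (funext fun i => hsep _ _ fun k => ?_))
    -- Stage `max k i` sees coordinate `i` and is at least as fine as `p k`.
    exact eq_of_le_of_coherent (Z := fun _ => ℝ) hcoh (le_max_left k i)
      (heq (le_max_right k i) (hxy (max k i)))
  · intro k
    rw [range_truncate_straighten hC hf]
    exact isArcTree_truncatedLimit (hp k) (hm k) (hp0 k) (hfin k)
      (upperSemicontinuous_hairHeight hC) (fun t => hairHeight_eq_zero hC) (hC.zero_notMem 0) k 1
  · intro k
    rw [range_truncate_straighten hC hf]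
    refine (Set.Nontrivial.image ?_ (Pi.single_injective k)).mono
      (single_image_subset_truncatedLimit (hp k) (hp0 k) k 1)
    exact ⟨0, ⟨le_rfl, (hp1 k).le⟩, p k 1, ⟨(hp1 k).le, le_rfl⟩, (hp1 k).ne⟩
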